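/- Let $B$ be a finite-dimensional $C^*$-algebra and let $\psi$ be a faithful state on $B$. Let $L^2(B)$ be the GNS space of $\psi$, with GNS map $\Lambda:B\to L^2(B)$, which is a linear isomorphism with $(\Lambda(a)|\Lambda(b))=\psi(a^*b)$ (inner products are linear in the second variable). Let $m:L^2(B)\otimes L^2(B)\to L^2(B)$, $m(\Lambda(a)\otimes\Lambda(b))=\Lambda(ab)$, be the multiplication, let $\eta:\mathbb C\to L^2(B)$, $\eta(\lambda)=\lambda\Lambda(1)$, be the unit map, and let $m^*$, $\eta^*$ be their Hilbert space adjoints. For a linear map $A$ on $L^2(B)$ consider the axioms $$\text{(idempotency)}\quad m(A\otimes A)m^*=A,\qquad \text{(undirectedness)}\quad (1\otimes\eta^*m)(1\otimes A\otimes 1)(m^*\eta\otimes 1)=A.$$ For a linear map $A_0:B\to B$ the same axioms are formulated by transporting $m,m^*,\eta,\eta^*$ to $B$ through $\Lambda$. Let $\operatorname{Tr}$ be the sum of the non-normalised matrix traces on $B\cong\bigoplus_k\mathbb M_{n_k}$, let $Q\in B$ be the unique positive invertible element with $\psi(a)=\operatorname{Tr}(Qa)$ for all $a \in B$, and put $\sigma_z(a)=Q^{iz}aQ^{-iz}$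 for $z\in\mathbb C$. Let $B^{\rm op}$ be the opposite algebra of $B$. Let $\Psi'$ be the linear map from the linear maps $B\to B$ to $B\otimes B^{\rm op}$ which sends $b\mapsto\psi(ab)c$ to $c\otimes\sigma_{-i/2}(a)$, for $a,c\in B$. For $t,s\in\mathbb R$ let $\Psi'_{t,s}$ be the linear map from the operators on $L^2(B)$ to $B\otimes B^{\rm op}$ which sends $\xi\mapsto(\Lambda(a)|\xi)\Lambda(b)$ to $\sigma_{it}(b)\otimes\sigma_{is}(a)^*$, for $a,b\in B$. Let $A_0:B\to B$ be a linear map and let $A:L^2(B)\to L^2(B)$ be the associated linear map, $A\Lambda(a)=\Lambda(A_0(a))$. Then $\Psi'(A_0)=\Psi'_{0,1/2}(A)$. Moreover, the following are equivalent: 1. $A_0$ is completely positive and $m(A_0\otimes A_0)m^*=A_0$; 2. $A$ is real, that is, $A_0(a^*)=A_0(a)^*$ for all $a\in B$, and $A$ satisfies the idempotency axiom. Also the following are equivalent: 3. $A_0$ is completely positive and satisfies the idempotency and undirectedness axioms; 4. $A$ is self-adjoint and satisfies the idempotency and undirectedness axioms. -/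

import Mathlib

open scoped TensorProduct InnerProductSpace ComplexOrder CStarAlgebra

noncomputable section

namespace QuantumGraph

/-! ### The canonical trace `Tr` of a finite-dimensional C*-algebra -/

section Trace

variable {B : Type*} [CStarAlgebra B]

theorem eq_zero_of_spectrum_subset {a : B} (ha : IsSelfAdjoint a)
    (h : ∀ z ∈ spectrum ℂ a, z = 0) : a = 0 := by
  have h1 := ha.spectralRadius_eq_nnnorm
  have h2 : spectralRadius ℂ a = 0 := by
    rw [spectralRadius, ENNReal.iSup_eq_zero]
    intro z
    rw [ENNReal.iSup_eq_zero]
    intro hz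
    simp [h z hz]
  rw [h2] at h1
  simpa using h1.symm

variable [FiniteDimensional ℂ B]

theorem isSemisimpleRing : IsSemisimpleRing B := by
  have : IsArtinianRing B := IsArtinianRing.of_finite ℂ B
  rw [IsArtinianRing.isSemisimpleRing_iff_jacobson, eq_bot_iff]
  intro x hx
  obtain ⟨n, hn⟩ := IsArtinianRing.isNilpotent_jacobson_bot (R := B)
  have h1 : star x * x ∈ Ring.jacobson B := Ideal.mul_mem_left _ _ hx
  have h2 : (star x * x) ^ n = 0 := by
    have h3 : (star x * x) ^ n ∈ (Ring.jacobson B) ^ n := Ideal.pow_mem_pow h1 n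
    rw [← Ideal.jacobson_bot, hn] at h3
    simpa using h3
  have h4 : star x * x = 0 := by
    refine eq_zero_of_spectrum_subset (IsSelfAdjoint.star_mul_self x) fun z hz => ?_
    by_contra hz0
    have := spectrum.pow_mem_pow (star x * x) n hz
    rw [h2] at this
    have : Nontrivial B := by
      by_contra hB
      have := not_nontrivial_iff_subsingleton.mp hB
      rw [spectrum.of_subsingleton] at hz
      exact hz
    rw [spectrum.zero_eq] at *
    simp_all
  simpa using h4

variable (B) in
/-- A finite-dimensional C*-algebra is a direct sum of full matrix algebras. -/
theorem exists_matrixDecomposition : ∃ (n : ℕ) (d : Fin n → ℕ),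
    Nonempty (B ≃ₐ[ℂ] Π i, Matrix (Fin (d i)) (Fin (d i)) ℂ) := by
  have : IsSemisimpleRing B := isSemisimpleRing
  obtain ⟨n, d, -, h⟩ := IsSemisimpleRing.exists_algEquiv_pi_matrix_of_isAlgClosed ℂ B
  exact ⟨n, d, h⟩

/-- The sum of the matrix traces along an isomorphism with a direct sum of matrix algebras. -/
def traceOf {n : ℕ} {d : Fin n → ℕ} (Φ : B ≃ₐ[ℂ] Π i, Matrix (Fin (d i)) (Fin (d i)) ℂ) :
    B →ₗ[ℂ] ℂ :=
  ∑ i, Matrix.traceLinearMap (Fin (d i)) ℂ ℂ ∘ₗ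
    LinearMap.proj (φ := fun i => Matrix (Fin (d i)) (Fin (d i)) ℂ) i ∘ₗ Φ.toLinearMap

variable (B) in
/-- The canonical trace `Tr` on `B ≅ ⨁ᵢ M_{dᵢ}(ℂ)`: the sum of the non-normalised matrix traces of
the blocks.  Since traces of matrices are invariant under automorphisms, the value does not depend
on the isomorphism, which need not be `*`-preserving. -/
def Tr : B →ₗ[ℂ] ℂ :=
  traceOf (exists_matrixDecomposition B).choose_spec.choose_spec.some

theorem exists_Tr_eq : ∃ (n : ℕ) (d : Fin n → ℕ)
    (Φ : B ≃ₐ[ℂ] Π i, Matrix (Fin (d i)) (Fin (d i)) ℂ),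
    ∀ a, Tr B a = ∑ i, (Φ a i).trace :=
  ⟨_, _, (exists_matrixDecomposition B).choose_spec.choose_spec.some, fun a => by
    simp [Tr, traceOf]⟩

theorem Tr_mul_comm (a b : B) : Tr B (a * b) = Tr B (b * a) := by
  obtain ⟨n, d, Φ, h⟩ := exists_Tr_eq (B := B)
  simp only [h, map_mul, Pi.mul_apply]
  exact Finset.sum_congr rfl fun i _ => Matrix.trace_mul_comm _ _

variable [PartialOrder B] [StarOrderedRing B]

theorem Tr_nonneg {a : B} (ha : 0 ≤ a) : 0 ≤ Tr B a ∧ (Tr B a = 0 → a = 0) := by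
  obtain ⟨n, d, Φ, h⟩ := exists_Tr_eq (B := B)
  have hs : ∀ i, ∀ z ∈ (Φ a i).charpoly.roots, z ∈ spectrum ℂ a ∧ 0 ≤ z := by
    intro i z hz
    have h1 : z ∈ spectrum ℂ (Φ a i) :=
      Matrix.mem_spectrum_of_isRoot_charpoly (Polynomial.isRoot_of_mem_roots hz)
    have h2 : z ∈ spectrum ℂ a := by
      rw [← AlgEquiv.spectrum_eq Φ a, Pi.spectrum_eq]
      exact Set.mem_iUnion.mpr ⟨i, h1⟩
    exact ⟨h2, spectrum_nonneg_of_nonneg ha h2⟩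
  have hn : ∀ i, 0 ≤ (Φ a i).trace := fun i => by
    rw [Matrix.trace_eq_sum_roots_charpoly]
    exact Multiset.sum_nonneg fun z hz => (hs i z hz).2
  refine ⟨by rw [h]; exact Finset.sum_nonneg fun i _ => hn i, fun h0 => ?_⟩
  rw [h, Finset.sum_eq_zero_iff_of_nonneg fun i _ => hn i] at h0
  refine eq_zero_of_spectrum_subset (IsSelfAdjoint.of_nonneg ha) fun z hz => ?_
  rw [← AlgEquiv.spectrum_eq Φ a, Pi.spectrum_eq] at hz
  obtain ⟨i, hi⟩ := Set.mem_iUnion.mp hz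
  have h1 := h0 i (Finset.mem_univ _)
  have hi' : z ∈ (Φ a i).charpoly.roots :=
    (Polynomial.mem_roots (Matrix.charpoly_monic _).ne_zero).mpr
      (Matrix.mem_spectrum_iff_isRoot_charpoly.mp hi)
  rw [Matrix.trace_eq_sum_roots_charpoly] at h1
  have h2 := Multiset.single_le_sum (fun w hw => (hs i w hw).2) z hi'
  rw [h1] at h2
  exact le_antisymm h2 (hs i z hi').2

theorem Tr_star (a : B) : Tr B (star a) = star (Tr B a) := by
  let τ : B →ₚ[ℂ] ℂ := PositiveLinearMap.mk₀ (Tr B) fun a ha => (Tr_nonneg ha).1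
  exact map_star τ a

theorem eq_zero_of_Tr {a : B} (h : ∀ b, Tr B (a * b) = 0) : a = 0 := by
  have h1 := (Tr_nonneg (mul_star_self_nonneg a)).2 (h (star a))
  simpa using h1

/-- A faithful positive functional. -/
def IsFaithful (ψ : B →ₚ[ℂ] ℂ) : Prop := ∀ a : B, ψ (star a * a) = 0 → a = 0

/-- The density of a faithful positive functional with respect to `Tr`. -/
theorem exists_density (ψ : B →ₚ[ℂ] ℂ) (hψ : IsFaithful ψ) :
    ∃! Q : B, 0 ≤ Q ∧ IsUnit Q ∧ ∀ a, ψ a = Tr B (Q * a) := by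
  let T : B →ₗ[ℂ] Module.Dual ℂ B := LinearMap.mk₂ ℂ (fun a b => Tr B (a * b))
    (by simp [add_mul]) (by simp) (by simp [mul_add]) (by simp)
  have hT : Function.Injective T := by
    rw [← LinearMap.ker_eq_bot, LinearMap.ker_eq_bot']
    exact fun a ha => eq_zero_of_Tr fun b => by simpa [T] using LinearMap.congr_fun ha b
  have hT' : Function.Surjective T :=
    (LinearMap.injective_iff_surjective_of_finrank_eq_finrank
      Subspace.dual_finrank_eq.symm).mp hT
  obtain ⟨Q, hQ⟩ := hT' (ψ : B →ₗ[ℂ] ℂ)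
  have hQ' : ∀ a, ψ a = Tr B (Q * a) := fun a => (LinearMap.congr_fun hQ a).symm
  have hsa : IsSelfAdjoint Q := by
    rw [IsSelfAdjoint, ← sub_eq_zero]
    refine eq_zero_of_Tr fun b => ?_
    have h1 : star Q * b = star (star b * Q) := by simp
    rw [sub_mul, map_sub, h1, Tr_star, Tr_mul_comm, ← hQ', ← hQ', map_star, star_star, sub_self]
  refine ⟨Q, ⟨?_, ?_, hQ'⟩, ?_⟩
  · have h1 : Q * Q⁻ = - (Q⁻ * Q⁻) := by
      have e : Q * Q⁻ = (Q⁺ - Q⁻) * Q⁻ :=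
        congrArg (· * Q⁻) (CFC.posPart_sub_negPart Q hsa).symm
      rw [e, sub_mul, CFC.posPart_mul_negPart, zero_sub]
    have hn : 0 ≤ Q⁻ := CFC.negPart_nonneg Q
    have hns : star (Q⁻) = Q⁻ := (IsSelfAdjoint.of_nonneg hn)
    have hnn : 0 ≤ Q⁻ * Q⁻ := by
      have := star_mul_self_nonneg (Q⁻)
      rwa [hns] at this
    have h2 : 0 ≤ ψ (Q⁻) := map_nonneg ψ hn
    rw [hQ', h1, map_neg] at h2
    have h3 : Tr B (Q⁻ * Q⁻) = 0 := le_antisymm (by simpa using h2) (Tr_nonneg hnn).1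
    have h4 : star (Q⁻) * Q⁻ = 0 := by rw [hns]; exact (Tr_nonneg hnn).2 h3
    have h5 : Q⁻ = 0 := by simpa using h4
    rw [← CFC.posPart_sub_negPart Q hsa, h5, sub_zero]
    exact CFC.posPart_nonneg Q
  · have hinj : Function.Injective (LinearMap.mulLeft ℂ Q) := by
      rw [← LinearMap.ker_eq_bot, LinearMap.ker_eq_bot']
      intro b hb
      have hb' : Q * b = 0 := hb
      have h1 : ψ (star (star b) * star b) = 0 := by
        rw [hQ', star_star, ← mul_assoc, hb']; simp
      simpa using hψ _ h1
    obtain ⟨R, hR⟩ := LinearMap.injective_iff_surjective.mp hinj 1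
    have hR' : Q * R = 1 := hR
    have hR2 : R * Q = 1 := hinj (by
      change Q * (R * Q) = Q * 1
      rw [← mul_assoc, hR', one_mul, mul_one])
    exact ⟨⟨Q, R, hR', hR2⟩, rfl⟩
  · rintro Q₂ ⟨-, -, h⟩
    rw [← sub_eq_zero]
    exact eq_zero_of_Tr fun b => by rw [sub_mul, map_sub, ← h, ← hQ', sub_self]

end Trace

/-! ### Axioms relative to a multiplication, a unit and their adjoints -/

section Axioms

variable {V : Type*} [AddCommGroup V] [Module ℂ V]

/-- The Schur product `m (S ⊗ T) m*`. -/
def schurProduct (m : V ⊗[ℂ] V →ₗ[ℂ] V) (m' : V →ₗ[ℂ] V ⊗[ℂ] V) (S T : V →ₗ[ℂ] V) : V →ₗ[ℂ] V :=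
  m ∘ₗ TensorProduct.map S T ∘ₗ m'

/-- The map `(1 ⊗ η* m) (1 ⊗ A ⊗ 1) (m* η ⊗ 1)`, from `V = ℂ ⊗ V` to `V ⊗ ℂ = V`. -/
def transposeMap (m : V ⊗[ℂ] V →ₗ[ℂ] V) (m' : V →ₗ[ℂ] V ⊗[ℂ] V) (η : ℂ →ₗ[ℂ] V)
    (η' : V →ₗ[ℂ] ℂ) (A : V →ₗ[ℂ] V) : V →ₗ[ℂ] V :=
  (TensorProduct.rid ℂ V).toLinearMap ∘ₗ
    TensorProduct.map LinearMap.id (η' ∘ₗ m) ∘ₗ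
    (TensorProduct.assoc ℂ V V V).toLinearMap ∘ₗ
    TensorProduct.map (TensorProduct.map LinearMap.id A) LinearMap.id ∘ₗ
    TensorProduct.map (m' ∘ₗ η) LinearMap.id ∘ₗ
    (TensorProduct.lid ℂ V).symm.toLinearMap

end Axioms

section Main

variable {B : Type*} [CStarAlgebra B] [PartialOrder B] [StarOrderedRing B]

/-! ### The GNS space `L²(B)` -/

/-- The GNS map `Λ : B → L²(B)`, with `(Λ a | Λ b) = ψ (a* b)`. -/
def gnsMap (ψ : B →ₚ[ℂ] ℂ) : B →ₗ[ℂ] ψ.GNS :=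
  (UniformSpace.Completion.toComplₗᵢ (𝕜 := ℂ) (E := ψ.PreGNS)).toLinearMap ∘ₗ
    ψ.toPreGNS.toLinearMap

theorem inner_gnsMap (ψ : B →ₚ[ℂ] ℂ) (a b : B) :
    ⟪gnsMap ψ a, gnsMap ψ b⟫_ℂ = ψ (star a * b) := by
  simp [gnsMap, PositiveLinearMap.preGNS_inner_def]

theorem gnsMap_injective (ψ : B →ₚ[ℂ] ℂ) (hψ : ∀ a : B, ψ (star a * a) = 0 → a = 0) :
    Function.Injective (gnsMap ψ) := by
  rw [← LinearMap.ker_eq_bot, LinearMap.ker_eq_bot']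
  intro a ha
  exact hψ a (by rw [← inner_gnsMap, ha, inner_zero_left])

variable [FiniteDimensional ℂ B]

theorem gnsMap_surjective (ψ : B →ₚ[ℂ] ℂ) : Function.Surjective (gnsMap ψ) := by
  have h1 : IsClosed (LinearMap.range (gnsMap ψ) : Set ψ.GNS) :=
    Submodule.closed_of_finiteDimensional _
  have h2 : DenseRange (gnsMap ψ) :=
    UniformSpace.Completion.denseRange_coe.comp
      (ψ.toPreGNS.surjective.denseRange) (UniformSpace.Completion.continuous_coe _)
  rw [← LinearMap.range_eq_top, ← SetLike.coe_set_eq, ← h1.closure_eq]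
  exact h2.closure_range

instance (ψ : B →ₚ[ℂ] ℂ) : FiniteDimensional ℂ ψ.GNS :=
  Module.Finite.of_surjective (gnsMap ψ) (gnsMap_surjective ψ)

variable (ψ : B →ₚ[ℂ] ℂ) (hψ : IsFaithful ψ)

/-- The GNS map `Λ` as a linear isomorphism `B ≅ L²(B)`. -/
def gnsEquiv : B ≃ₗ[ℂ] ψ.GNS :=
  LinearEquiv.ofBijective (gnsMap ψ) ⟨gnsMap_injective ψ hψ, gnsMap_surjective ψ⟩

/-! ### The structure maps on `L²(B)` and on `B` -/

/-- The multiplication `m : L²(B) ⊗ L²(B) → L²(B)`. -/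
def mulL2 : ψ.GNS ⊗[ℂ] ψ.GNS →ₗ[ℂ] ψ.GNS :=
  (gnsEquiv ψ hψ).toLinearMap ∘ₗ LinearMap.mul' ℂ B ∘ₗ
    TensorProduct.map (gnsEquiv ψ hψ).symm.toLinearMap (gnsEquiv ψ hψ).symm.toLinearMap

/-- The Hilbert space adjoint `m*` of the multiplication. -/
def mulL2Adj : ψ.GNS →ₗ[ℂ] ψ.GNS ⊗[ℂ] ψ.GNS :=
  LinearMap.adjoint (mulL2 ψ hψ)

/-- The unit map `η : ℂ → L²(B)`, `z ↦ z • Λ 1`. -/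
def unitL2 : ℂ →ₗ[ℂ] ψ.GNS :=
  LinearMap.toSpanSingleton ℂ ψ.GNS (gnsMap ψ 1)

/-- The Hilbert space adjoint `η*` of the unit map. -/
def unitL2Adj : ψ.GNS →ₗ[ℂ] ℂ :=
  LinearMap.adjoint (unitL2 ψ)

/-- The map `m*`, transported to `B → B ⊗ B`. -/
def mulAdj : B →ₗ[ℂ] B ⊗[ℂ] B :=
  TensorProduct.map (gnsEquiv ψ hψ).symm.toLinearMap (gnsEquiv ψ hψ).symm.toLinearMap ∘ₗ
    mulL2Adj ψ hψ ∘ₗ (gnsEquiv ψ hψ).toLinearMap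

/-- The map `η*`, transported to `B → ℂ`. -/
def unitAdj : B →ₗ[ℂ] ℂ :=
  unitL2Adj ψ ∘ₗ (gnsEquiv ψ hψ).toLinearMap

/-- The idempotency axiom `m (A ⊗ A) m* = A` for an operator on `L²(B)`. -/
def OpIdempotent (A : ψ.GNS →ₗ[ℂ] ψ.GNS) : Prop :=
  schurProduct (mulL2 ψ hψ) (mulL2Adj ψ hψ) A A = A

/-- The undirectedness axiom `(1 ⊗ η* m) (1 ⊗ A ⊗ 1) (m* η ⊗ 1) = A` for an operator on
`L²(B)`. -/
def OpUndirected (A : ψ.GNS →ₗ[ℂ] ψ.GNS) : Prop :=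
  transposeMap (mulL2 ψ hψ) (mulL2Adj ψ hψ) (unitL2 ψ) (unitL2Adj ψ) A = A

/-- `A` is real: the map `A₀ = Λ⁻¹ A Λ` satisfies `A₀ (a*) = (A₀ a)*`. -/
def OpReal (A : ψ.GNS →ₗ[ℂ] ψ.GNS) : Prop :=
  ∀ a : B, (gnsEquiv ψ hψ).symm (A (gnsEquiv ψ hψ (star a))) =
    star ((gnsEquiv ψ hψ).symm (A (gnsEquiv ψ hψ a)))

/-- The axiom `m (A₀ ⊗ A₀) m* = A₀` for a map on `B`. -/
def SuperIdempotent (A₀ : B →ₗ[ℂ] B) : Prop :=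
  schurProduct (LinearMap.mul' ℂ B) (mulAdj ψ hψ) A₀ A₀ = A₀

/-- The axiom `(1 ⊗ η* m) (1 ⊗ A₀ ⊗ 1) (m* η ⊗ 1) = A₀` for a map on `B`. -/
def SuperUndirected (A₀ : B →ₗ[ℂ] B) : Prop :=
  transposeMap (LinearMap.mul' ℂ B) (mulAdj ψ hψ) (Algebra.linearMap ℂ B) (unitAdj ψ hψ) A₀ = A₀

/-- Complete positivity of a linear map. -/
def IsCompletelyPositive (A₀ : B →ₗ[ℂ] B) : Prop :=
  ∃ φ : B →CP B, ∀ b, φ b = A₀ b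

/-! ### The modular automorphism group -/

/-- The density `Q`: the unique positive invertible element with `ψ a = Tr (Q a)`. -/
def density : B := (exists_density ψ hψ).choose

theorem density_spec : 0 ≤ density ψ hψ ∧ IsUnit (density ψ hψ) ∧
    ∀ a, ψ a = Tr B (density ψ hψ * a) :=
  (exists_density ψ hψ).choose_spec.1

/-- The complex power `Q ^ z`, by functional calculus. -/
def densityPow (z : ℂ) : B := cfc (fun x : ℂ => x ^ z) (density ψ hψ)

/-- `σ_z a = Q^{iz} a Q^{-iz}`. -/
def modular (z : ℂ) : B →ₗ[ℂ] B :=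
  LinearMap.mulLeft ℂ (densityPow ψ hψ (Complex.I * z)) ∘ₗ
    LinearMap.mulRight ℂ (densityPow ψ hψ (-(Complex.I * z)))

/-! ### The maps `Ψ'` -/

/-- The map `a ↦ ψ a := (b ↦ ψ (a b))` from `B` to its dual. -/
def toDualMap : B →ₗ[ℂ] Module.Dual ℂ B :=
  LinearMap.mk₂ ℂ (fun a b => ψ (a * b)) (by simp [add_mul]) (by simp) (by simp [mul_add])
    (by simp)

theorem toDualMap_injective (ψ : B →ₚ[ℂ] ℂ) (hψ : IsFaithful ψ) :
    Function.Injective (toDualMap ψ) := by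
  rw [← LinearMap.ker_eq_bot, LinearMap.ker_eq_bot']
  intro a ha
  have h1 : ψ (star (star a) * star a) = 0 := by
    simpa [toDualMap] using LinearMap.congr_fun ha (star a)
  simpa using hψ _ h1

/-- The linear isomorphism `a ↦ (b ↦ ψ (a b))` from `B` to its dual. -/
def toDualEquiv : B ≃ₗ[ℂ] Module.Dual ℂ B :=
  LinearEquiv.ofBijective (toDualMap ψ) ⟨toDualMap_injective ψ hψ,
    (LinearMap.injective_iff_surjective_of_finrank_eq_finrank
      Subspace.dual_finrank_eq.symm).mp (toDualMap_injective ψ hψ)⟩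

/-- The linear map `(b ↦ ψ (a b)) ↦ σ_{-i/2} a` from `B*` to `B^op`. -/
def superLeg : Module.Dual ℂ B →ₗ[ℂ] Bᵐᵒᵖ :=
  (MulOpposite.opLinearEquiv ℂ).toLinearMap ∘ₗ modular ψ hψ (-Complex.I / 2) ∘ₗ
    (toDualEquiv ψ hψ).symm.toLinearMap

/-- The map `Ψ'` on linear maps `B → B`: the linear map sending `b ↦ ψ (a b) c` to
`c ⊗ σ_{-i/2} a` in `B ⊗ B^op`. -/
def superPsi : (B →ₗ[ℂ] B) →ₗ[ℂ] B ⊗[ℂ] Bᵐᵒᵖ :=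
  (TensorProduct.comm ℂ Bᵐᵒᵖ B).toLinearMap ∘ₗ
    TensorProduct.map (superLeg ψ hψ) LinearMap.id ∘ₗ
    (dualTensorHomEquiv ℂ B B).symm.toLinearMap

theorem superPsi_rankOne (a c : B) :
    superPsi ψ hψ ((toDualMap ψ a).smulRight c) =
      c ⊗ₜ[ℂ] MulOpposite.op (modular ψ hψ (-Complex.I / 2) a) := by
  have h1 : (dualTensorHomEquiv ℂ B B).symm ((toDualMap ψ a).smulRight c) =
      toDualMap ψ a ⊗ₜ[ℂ] c := by
    rw [LinearEquiv.symm_apply_eq]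
    ext b
    simp [dualTensorHomEquiv]
  have h2 : (toDualEquiv ψ hψ).symm (toDualMap ψ a) = a := by
    rw [LinearEquiv.symm_apply_eq]
    rfl
  simp only [superPsi, LinearMap.comp_apply, LinearEquiv.coe_coe, h1, TensorProduct.map_tmul,
    superLeg, h2, LinearMap.id_apply, TensorProduct.comm_tmul, MulOpposite.coe_opLinearEquiv]

/-- The linear map `(Λ a | ·) ↦ (σ_{is} a)*` from `L²(B)*` to `B^op`. -/
def opLeg (s : ℝ) : Module.Dual ℂ ψ.GNS →ₗ[ℂ] Bᵐᵒᵖ where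
  toFun f := MulOpposite.op (star (modular ψ hψ (Complex.I * s) ((gnsEquiv ψ hψ).symm
    ((InnerProductSpace.toDual ℂ ψ.GNS).symm (LinearMap.toContinuousLinearMap f)))))
  map_add' f g := by simp
  map_smul' z f := by
    rw [map_smul, map_smulₛₗ, map_smul, map_smul, star_smul, MulOpposite.op_smul]
    simp

theorem opLeg_apply (s : ℝ) (a : B) :
    opLeg ψ hψ s (innerₛₗ ℂ (gnsEquiv ψ hψ a)) =
      MulOpposite.op (star (modular ψ hψ (Complex.I * s) a)) := by
  have h2 : (InnerProductSpace.toDual ℂ ψ.GNS).symm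
      (LinearMap.toContinuousLinearMap (innerₛₗ ℂ (gnsEquiv ψ hψ a))) = gnsEquiv ψ hψ a := by
    rw [LinearIsometryEquiv.symm_apply_eq]
    ext b
    simp
  change MulOpposite.op (star (modular ψ hψ (Complex.I * s) ((gnsEquiv ψ hψ).symm
    ((InnerProductSpace.toDual ℂ ψ.GNS).symm
      (LinearMap.toContinuousLinearMap (innerₛₗ ℂ (gnsEquiv ψ hψ a))))))) = _
  rw [h2, LinearEquiv.symm_apply_apply]

/-- The map `Ψ'_{t,s}` on operators on `L²(B)`: the linear map sending the rank-one operator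
`ξ ↦ (Λ a | ξ) Λ b` to `σ_{it} b ⊗ (σ_{is} a)*` in `B ⊗ B^op`. -/
def opPsi (t s : ℝ) : (ψ.GNS →ₗ[ℂ] ψ.GNS) →ₗ[ℂ] B ⊗[ℂ] Bᵐᵒᵖ :=
  (TensorProduct.comm ℂ Bᵐᵒᵖ B).toLinearMap ∘ₗ
    TensorProduct.map (opLeg ψ hψ s)
      (modular ψ hψ (Complex.I * t) ∘ₗ (gnsEquiv ψ hψ).symm.toLinearMap) ∘ₗ
    (dualTensorHomEquiv ℂ ψ.GNS ψ.GNS).symm.toLinearMap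

theorem opPsi_rankOne (t s : ℝ) (a b : B) :
    opPsi ψ hψ t s ((innerₛₗ ℂ (gnsEquiv ψ hψ a)).smulRight (gnsEquiv ψ hψ b)) =
      modular ψ hψ (Complex.I * t) b ⊗ₜ[ℂ]
        MulOpposite.op (star (modular ψ hψ (Complex.I * s) a)) := by
  have h1 : (dualTensorHomEquiv ℂ ψ.GNS ψ.GNS).symm
      ((innerₛₗ ℂ (gnsEquiv ψ hψ a)).smulRight (gnsEquiv ψ hψ b)) =
      (innerₛₗ ℂ (gnsEquiv ψ hψ a) : Module.Dual ℂ ψ.GNS) ⊗ₜ[ℂ] gnsEquiv ψ hψ b := by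
    rw [LinearEquiv.symm_apply_eq]
    ext b
    simp [dualTensorHomEquiv]
  simp only [opPsi, LinearMap.comp_apply, LinearEquiv.coe_coe, h1, TensorProduct.map_tmul,
    opLeg_apply, LinearEquiv.symm_apply_apply, TensorProduct.comm_tmul]

end Main

end QuantumGraph

end

/-!
Choose `hᵢ ∈ B` such that the vectors `Λ hᵢ` form an orthonormal basis of `L²(B)`.  Then every
`x ∈ B` satisfies `x = ∑ᵢ ψ (x hᵢ) hᵢ*`, and comparing inner products with `Λ x ⊗ Λ y` gives
`m* (a b) = ∑ᵢ a hᵢ ⊗ hᵢ* b` (`mulL2Adj_gnsEquiv_mul`).  Hence the two axioms become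

* idempotency: `A₀ (a b) = ∑ᵢ A₀ (a hᵢ) A₀ (hᵢ* b)` for all `a`, `b` (`superIdempotent_iff`);
* undirectedness: `ψ (x A₀ v) = ψ (A₀ x v)` for all `x`, `v` (`superUndirected_iff`).

If `A₀` is real and idempotent, the first identity with `a = c*` reads
`A₀ (c* d) = ∑ᵢ (A₀ (hᵢ* c))* A₀ (hᵢ* d)`, from which complete positivity is immediate
(`isCompletelyPositive_of_sum`); conversely a positive map preserves the involution.  This is the
first equivalence.  For the second, self-adjointness of `A` means `ψ (x* A₀ v) = ψ ((A₀ x)* v)`, so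
for an undirected `A` it is the same as reality (`adjoint_eq_self_iff_real`).

The identity `Ψ' = Ψ'_{0,1/2}` is checked on rank-one maps, where it is the formula
`(σ_{i/2} (a*))* = σ_{-i/2} a`, a case of `star_modular`.
-/

noncomputable section

namespace QuantumGraph

/-! ### Complete positivity -/

section CompletePositivity

variable {B : Type*} [CStarAlgebra B] [PartialOrder B] [StarOrderedRing B] {A₀ : B →ₗ[ℂ] B}

theorem map_star_of_isCompletelyPositive (h : IsCompletelyPositive A₀) (a : B) :
    A₀ (star a) = star (A₀ a) := by
  obtain ⟨φ, hφ⟩ := h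
  rw [← hφ, ← hφ, map_star φ]

theorem cstarMatrix_sum_apply {m n κ R : Type*} [AddCommMonoid R] (s : Finset κ)
    (F : κ → CStarMatrix m n R) (j : m) (l : n) : (∑ x ∈ s, F x) j l = ∑ x ∈ s, F x j l :=
  Matrix.sum_apply j l s F

/-- A map of Stinespring form `A₀ (c* d) = ∑ᵢ (Sᵢ c)* (Sᵢ d)` is completely positive. -/
theorem isCompletelyPositive_of_sum {ι : Type*} [Fintype ι] (S : ι → B → B)
    (h : ∀ c d, A₀ (star c * d) = ∑ i, star (S i c) * S i d) : IsCompletelyPositive A₀ := by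
  refine ⟨⟨A₀, fun k M hM => ?_⟩, fun b => rfl⟩
  -- The positive matrices are generated, under addition, by those of the form `N* N`.
  rw [StarOrderedRing.nonneg_iff] at hM
  induction hM using AddSubmonoid.closure_induction with
  | zero =>
    have h0 : (0 : CStarMatrix (Fin k) (Fin k) B).map A₀ = 0 := by ext; simp
    exact h0.ge
  | add M N _ _ hM hN =>
    have hadd : (M + N).map A₀ = M.map A₀ + N.map A₀ := by ext; simp
    exact (add_nonneg hM hN).trans_eq hadd.symm
  | mem M hM =>
    obtain ⟨N, rfl⟩ := hM
    -- The entries of `A₀ (N* N)` are those of a sum of matrices `W* W`, where each `W` has a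
    -- single non-zero row, put at index `p`.
    let W (p : Fin k) (i : ι) : CStarMatrix (Fin k) (Fin k) B :=
      CStarMatrix.ofMatrix (Matrix.of fun q j => if q = p then S i (N p j) else 0)
    have hW : (star N * N).map A₀ = ∑ p, ∑ i, star (W p i) * W p i := by
      refine CStarMatrix.ext fun j l => ?_
      simp only [cstarMatrix_sum_apply]
      simp [CStarMatrix.mul_apply, CStarMatrix.star_apply, h, W, apply_ite star]
    exact (Finset.sum_nonneg fun p _ => Finset.sum_nonneg fun i _ =>
      star_mul_self_nonneg (W p i)).trans_eq hW.symm

end CompletePositivity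

section FiniteDimensional

variable {B : Type*} [CStarAlgebra B] [PartialOrder B] [StarOrderedRing B]
  [FiniteDimensional ℂ B] (ψ : B →ₚ[ℂ] ℂ) (hψ : IsFaithful ψ)

/-! ### The modular group and the involution -/

theorem star_densityPow (z : ℂ) : star (densityPow ψ hψ z) = densityPow ψ hψ (star z) := by
  rw [densityPow, densityPow, ← cfc_star]
  -- Conjugation commutes with `x ↦ x ^ z` off the negative axis, hence on the spectrum of `Q`.
  refine cfc_congr fun x hx => ?_
  have hx0 : 0 ≤ x := spectrum_nonneg_of_nonneg (density_spec ψ hψ).1 hx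
  obtain ⟨r, hr, rfl⟩ : ∃ r : ℝ, 0 ≤ r ∧ (r : ℂ) = x :=
    ⟨x.re, (Complex.nonneg_iff.mp hx0).1, Complex.ext rfl (Complex.nonneg_iff.mp hx0).2⟩
  have harg : (r : ℂ).arg ≠ Real.pi := by
    rw [Complex.arg_ofReal_of_nonneg hr]
    exact Real.pi_ne_zero.symm
  simp [Complex.cpow_conj _ _ harg]

theorem star_modular (z : ℂ) (a : B) :
    star (modular ψ hψ z a) = modular ψ hψ (star z) (star a) := by
  simp [modular, star_densityPow, mul_assoc]

theorem modular_zero (a : B) : modular ψ hψ 0 a = a := by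
  have hQ : IsStarNormal (density ψ hψ) :=
    (IsSelfAdjoint.of_nonneg (density_spec ψ hψ).1).isStarNormal
  have h : densityPow ψ hψ 0 = 1 := by
    simp only [densityPow, Complex.cpow_zero]
    exact cfc_const_one ℂ _
  simp [modular, h]

/-! ### The maps `Ψ'` -/

theorem conj_toDualMap_smulRight (a c : B) :
    (gnsEquiv ψ hψ).toLinearMap ∘ₗ (toDualMap ψ a).smulRight c ∘ₗ
        (gnsEquiv ψ hψ).symm.toLinearMap =
      (innerₛₗ ℂ (gnsEquiv ψ hψ (star a))).smulRight (gnsEquiv ψ hψ c) := by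
  ext ξ
  obtain ⟨b, rfl⟩ := (gnsEquiv ψ hψ).surjective ξ
  have h : ⟪gnsEquiv ψ hψ (star a), gnsEquiv ψ hψ b⟫_ℂ = ψ (a * b) := by
    simpa using! inner_gnsMap ψ (star a) b
  simp [toDualMap, h]

/-- It suffices to compare rank-one maps, for which the claim is `(σ_{i/2} (a*))* = σ_{-i/2} a`. -/
theorem superPsi_eq_opPsi_conj (A₀ : B →ₗ[ℂ] B) :
    superPsi ψ hψ A₀ = opPsi ψ hψ 0 (1 / 2)
      ((gnsEquiv ψ hψ).toLinearMap ∘ₗ A₀ ∘ₗ (gnsEquiv ψ hψ).symm.toLinearMap) := by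
  obtain ⟨x, rfl⟩ := (dualTensorHomEquiv ℂ B B).surjective A₀
  induction x using TensorProduct.induction_on with
  | zero => simp
  | add x y hx hy => simp only [map_add, LinearMap.add_comp, LinearMap.comp_add, hx, hy]
  | tmul f c =>
    obtain ⟨a, rfl⟩ := (toDualEquiv ψ hψ).surjective f
    have h1 : dualTensorHomEquiv ℂ B B (toDualEquiv ψ hψ a ⊗ₜ c) =
        (toDualMap ψ a).smulRight c := by
      ext b
      simp [dualTensorHomEquiv]
      rfl
    have h2 : star (Complex.I * ((1 / 2 : ℝ) : ℂ)) = -Complex.I / 2 := by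
      simp only [star_mul', RCLike.star_def, Complex.conj_I, Complex.conj_ofReal]
      push_cast
      ring
    rw [h1, superPsi_rankOne, conj_toDualMap_smulRight, opPsi_rankOne, star_modular, star_star, h2]
    simp [modular_zero]

/-! ### An orthonormal basis and the adjoint of the multiplication -/

/-- The elements `hᵢ ∈ B` whose images `Λ hᵢ` form an orthonormal basis of `L²(B)`. -/
def gnsBasis (i : Fin (Module.finrank ℂ ψ.GNS)) : B :=
  (gnsEquiv ψ hψ).symm (stdOrthonormalBasis ℂ ψ.GNS i)

theorem inner_gnsEquiv (a b : B) :
    ⟪gnsEquiv ψ hψ a, gnsEquiv ψ hψ b⟫_ℂ = ψ (star a * b) :=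
  inner_gnsMap ψ a b

theorem sum_smul_gnsBasis (x : B) :
    ∑ i, ψ (star (gnsBasis ψ hψ i) * x) • gnsBasis ψ hψ i = x := by
  apply (gnsEquiv ψ hψ).injective
  rw [← (stdOrthonormalBasis ℂ ψ.GNS).sum_repr' (gnsEquiv ψ hψ x)]
  simp [← inner_gnsEquiv ψ hψ, gnsBasis]

theorem sum_smul_star_gnsBasis (x : B) :
    ∑ i, ψ (x * gnsBasis ψ hψ i) • star (gnsBasis ψ hψ i) = x := by
  have h := congrArg star (sum_smul_gnsBasis ψ hψ (star x))
  simpa [star_sum, ← map_star] using h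

theorem unitL2Adj_gnsEquiv (a : B) : unitL2Adj ψ (gnsEquiv ψ hψ a) = ψ a := by
  have h : ⟪(1 : ℂ), unitL2Adj ψ (gnsEquiv ψ hψ a)⟫_ℂ = ψ a := by
    rw [unitL2Adj, LinearMap.adjoint_inner_right]
    simpa [unitL2] using! inner_gnsMap ψ 1 a
  simpa using h

theorem mulL2_gnsEquiv_tmul (a b : B) :
    mulL2 ψ hψ (gnsEquiv ψ hψ a ⊗ₜ gnsEquiv ψ hψ b) = gnsEquiv ψ hψ (a * b) := by
  simp [mulL2]

/-- This says that `m* Λ(1) = ∑ᵢ Λ(hᵢ) ⊗ Λ(hᵢ*)` and that `m*` is a bimodule map.  It holds because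
both sides have the inner product `ψ (y* x* a b)` with `Λ(x) ⊗ Λ(y)`. -/
theorem mulL2Adj_gnsEquiv_mul (a b : B) :
    mulL2Adj ψ hψ (gnsEquiv ψ hψ (a * b)) =
      ∑ i, gnsEquiv ψ hψ (a * gnsBasis ψ hψ i) ⊗ₜ
        gnsEquiv ψ hψ (star (gnsBasis ψ hψ i) * b) := by
  rw [TensorProduct.ext_iff_inner_left (𝕜 := ℂ)]
  intro ξ ζ
  obtain ⟨x, rfl⟩ := (gnsEquiv ψ hψ).surjective ξ
  obtain ⟨y, rfl⟩ := (gnsEquiv ψ hψ).surjective ζ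
  rw [mulL2Adj, LinearMap.adjoint_inner_right, mulL2_gnsEquiv_tmul, inner_gnsEquiv, inner_sum]
  simp only [TensorProduct.inner_tmul, inner_gnsEquiv]
  -- Expand `x* a` in the elements `hᵢ*`.
  have h : star (x * y) * (a * b) = star y * (star x * a) * b := by simp [mul_assoc]
  rw [h]
  conv_lhs => rw [← sum_smul_star_gnsBasis ψ hψ (star x * a)]
  simp [Finset.mul_sum, Finset.sum_mul, mul_assoc]

theorem mulAdj_mul (a b : B) :
    mulAdj ψ hψ (a * b) =
      ∑ i, (a * gnsBasis ψ hψ i) ⊗ₜ (star (gnsBasis ψ hψ i) * b) := by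
  simp [mulAdj, mulL2Adj_gnsEquiv_mul]

/-! ### The axioms in terms of the basis -/

theorem superIdempotent_iff (A₀ : B →ₗ[ℂ] B) :
    SuperIdempotent ψ hψ A₀ ↔ ∀ a b, A₀ (a * b) =
      ∑ i, A₀ (a * gnsBasis ψ hψ i) * A₀ (star (gnsBasis ψ hψ i) * b) := by
  have h : ∀ a b, schurProduct (LinearMap.mul' ℂ B) (mulAdj ψ hψ) A₀ A₀ (a * b) =
      ∑ i, A₀ (a * gnsBasis ψ hψ i) * A₀ (star (gnsBasis ψ hψ i) * b) := fun a b => by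
    simp [schurProduct, mulAdj_mul]
  refine ⟨fun hA a b => by rw [← h, hA], fun hA => LinearMap.ext fun b => ?_⟩
  rw [← one_mul b, h, hA]

/-- Undirectedness is symmetry of `A₀` for the bilinear form `(x, y) ↦ ψ (x y)`. -/
theorem superUndirected_iff (A₀ : B →ₗ[ℂ] B) :
    SuperUndirected ψ hψ A₀ ↔ ∀ x v, ψ (x * A₀ v) = ψ (A₀ x * v) := by
  have h : ∀ v, transposeMap (LinearMap.mul' ℂ B) (mulAdj ψ hψ) (Algebra.linearMap ℂ B)
      (unitAdj ψ hψ) A₀ v =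
      ∑ i, ψ (A₀ (star (gnsBasis ψ hψ i)) * v) • gnsBasis ψ hψ i := fun v => by
    have h1 := mulAdj_mul ψ hψ 1 1
    simp only [mul_one, one_mul] at h1
    simp [transposeMap, h1, TensorProduct.sum_tmul, unitAdj, unitL2Adj_gnsEquiv]
  have h2 : ∀ x v, ψ (x * ∑ i, ψ (A₀ (star (gnsBasis ψ hψ i)) * v) • gnsBasis ψ hψ i) =
      ψ (A₀ x * v) := fun x v => by
    conv_rhs => rw [← sum_smul_star_gnsBasis ψ hψ x]
    simp [Finset.mul_sum, Finset.sum_mul, mul_comm]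
  constructor
  · intro hA x v
    rw [← h2, ← h, hA]
  · intro hA
    refine LinearMap.ext fun v => sub_eq_zero.mp (hψ _ ?_)
    rw [h, mul_sub, map_sub, h2, hA, sub_self]

/-! ### Transport along the GNS map -/

variable {ψ hψ} {A₀ : B →ₗ[ℂ] B} {A : ψ.GNS →ₗ[ℂ] ψ.GNS}

theorem opIdempotent_iff_superIdempotent
    (hA : ∀ a : B, A (gnsEquiv ψ hψ a) = gnsEquiv ψ hψ (A₀ a)) :
    OpIdempotent ψ hψ A ↔ SuperIdempotent ψ hψ A₀ := by
  have h : ∀ a b, schurProduct (mulL2 ψ hψ) (mulL2Adj ψ hψ) A A (gnsEquiv ψ hψ (a * b)) =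
      gnsEquiv ψ hψ
        (∑ i, A₀ (a * gnsBasis ψ hψ i) * A₀ (star (gnsBasis ψ hψ i) * b)) := fun a b => by
    simp [schurProduct, mulL2Adj_gnsEquiv_mul, hA, mulL2_gnsEquiv_tmul]
  rw [superIdempotent_iff]
  refine ⟨fun hi a b => (gnsEquiv ψ hψ).injective (by rw [← h, hi, hA]),
    fun hi => LinearMap.ext fun ξ => ?_⟩
  obtain ⟨b, rfl⟩ := (gnsEquiv ψ hψ).surjective ξ
  rw [← one_mul b, h, hA, hi]

theorem opUndirected_iff_superUndirected
    (hA : ∀ a : B, A (gnsEquiv ψ hψ a) = gnsEquiv ψ hψ (A₀ a)) :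
    OpUndirected ψ hψ A ↔ SuperUndirected ψ hψ A₀ := by
  have h : ∀ v, transposeMap (mulL2 ψ hψ) (mulL2Adj ψ hψ) (unitL2 ψ) (unitL2Adj ψ) A
      (gnsEquiv ψ hψ v) = gnsEquiv ψ hψ (transposeMap (LinearMap.mul' ℂ B) (mulAdj ψ hψ)
        (Algebra.linearMap ℂ B) (unitAdj ψ hψ) A₀ v) := fun v => by
    have h1 := mulAdj_mul ψ hψ 1 1
    have h2 := mulL2Adj_gnsEquiv_mul ψ hψ 1 1
    simp only [mul_one, one_mul] at h1 h2
    have h3 : unitL2 ψ 1 = gnsEquiv ψ hψ 1 := one_smul ℂ (gnsMap ψ 1)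
    simp [transposeMap, h1, h2, h3, TensorProduct.sum_tmul, unitAdj, hA, mulL2_gnsEquiv_tmul]
  refine ⟨fun hu => LinearMap.ext fun v => (gnsEquiv ψ hψ).injective (by rw [← h, hu, hA]),
    fun hu => LinearMap.ext fun ξ => ?_⟩
  obtain ⟨v, rfl⟩ := (gnsEquiv ψ hψ).surjective ξ
  rw [h, hu, hA]

theorem opReal_iff (hA : ∀ a : B, A (gnsEquiv ψ hψ a) = gnsEquiv ψ hψ (A₀ a)) :
    OpReal ψ hψ A ↔ ∀ a, A₀ (star a) = star (A₀ a) := by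
  simp [OpReal, hA]

/-- The undirectedness axiom says that `A₀` is its own transpose for the bilinear form `ψ (x y)`,
whereas self-adjointness says this for the sesquilinear form `ψ (x* y)`; for an undirected `A` the
two differ exactly by reality. -/
theorem adjoint_eq_self_iff_real (hA : ∀ a : B, A (gnsEquiv ψ hψ a) = gnsEquiv ψ hψ (A₀ a))
    (hu : SuperUndirected ψ hψ A₀) :
    LinearMap.adjoint A = A ↔ ∀ a, A₀ (star a) = star (A₀ a) := by
  rw [superUndirected_iff] at hu
  have h : LinearMap.adjoint A = A ↔ ∀ x v, ψ (star (A₀ x) * v) = ψ (A₀ (star x) * v) := by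
    rw [← LinearMap.isSelfAdjoint_iff', ← LinearMap.isSymmetric_iff_isSelfAdjoint]
    refine ⟨fun hs x v => ?_, fun hs ξ ζ => ?_⟩
    · have := hs (gnsEquiv ψ hψ x) (gnsEquiv ψ hψ v)
      rwa [hA, hA, inner_gnsEquiv, inner_gnsEquiv, hu] at this
    · obtain ⟨x, rfl⟩ := (gnsEquiv ψ hψ).surjective ξ
      obtain ⟨v, rfl⟩ := (gnsEquiv ψ hψ).surjective ζ
      rw [hA, hA, inner_gnsEquiv, inner_gnsEquiv, hu, hs]
  rw [h]
  refine ⟨fun hs a => ?_, fun hr x v => by rw [hr]⟩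
  exact toDualMap_injective ψ hψ (LinearMap.ext fun v => (hs a v).symm)

/-! ### Real Schur idempotents -/

/-- With `a = c*` in `superIdempotent_iff`, reality turns the factor `A₀ (c* hᵢ)` into
`(A₀ (hᵢ* c))*`, which is a Stinespring form with `Sᵢ d = A₀ (hᵢ* d)`. -/
theorem isCompletelyPositive_of_real (hi : SuperIdempotent ψ hψ A₀)
    (hr : ∀ a, A₀ (star a) = star (A₀ a)) : IsCompletelyPositive A₀ := by
  refine isCompletelyPositive_of_sum (fun i d => A₀ (star (gnsBasis ψ hψ i) * d)) fun c d => ?_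
  rw [(superIdempotent_iff ψ hψ A₀).mp hi]
  simp [← hr]

end FiniteDimensional

end QuantumGraph

end

theorem mainTheorem9 {B : Type*} [CStarAlgebra B] [PartialOrder B] [StarOrderedRing B]
    [FiniteDimensional ℂ B] (ψ : B →ₚ[ℂ] ℂ) (hψ_one : ψ 1 = 1)
    (hψ : QuantumGraph.IsFaithful ψ) (A₀ : B →ₗ[ℂ] B) (A : ψ.GNS →ₗ[ℂ] ψ.GNS)
    (hA : ∀ a : B, A (QuantumGraph.gnsEquiv ψ hψ a) = QuantumGraph.gnsEquiv ψ hψ (A₀ a)) :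
    QuantumGraph.superPsi ψ hψ A₀ = QuantumGraph.opPsi ψ hψ 0 (1 / 2) A ∧
    ((QuantumGraph.IsCompletelyPositive A₀ ∧ QuantumGraph.SuperIdempotent ψ hψ A₀) ↔
      (QuantumGraph.OpReal ψ hψ A ∧ QuantumGraph.OpIdempotent ψ hψ A)) ∧
    ((QuantumGraph.IsCompletelyPositive A₀ ∧ QuantumGraph.SuperIdempotent ψ hψ A₀ ∧
        QuantumGraph.SuperUndirected ψ hψ A₀) ↔
      (LinearMap.adjoint A = A ∧ QuantumGraph.OpIdempotent ψ hψ A ∧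
        QuantumGraph.OpUndirected ψ hψ A)) := by
  have hconj : A = (QuantumGraph.gnsEquiv ψ hψ).toLinearMap ∘ₗ A₀ ∘ₗ
      (QuantumGraph.gnsEquiv ψ hψ).symm.toLinearMap := by
    ext ξ
    obtain ⟨b, rfl⟩ := (QuantumGraph.gnsEquiv ψ hψ).surjective ξ
    simp [hA]
  rw [QuantumGraph.opIdempotent_iff_superIdempotent hA,
    QuantumGraph.opUndirected_iff_superUndirected hA, QuantumGraph.opReal_iff hA]
  refine ⟨?_, ⟨?_, ?_⟩, ⟨?_, ?_⟩⟩
  · rw [hconj]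
    exact QuantumGraph.superPsi_eq_opPsi_conj ψ hψ A₀
  · rintro ⟨hcp, hi⟩
    exact ⟨QuantumGraph.map_star_of_isCompletelyPositive hcp, hi⟩
  · rintro ⟨hr, hi⟩
    exact ⟨QuantumGraph.isCompletelyPositive_of_real hi hr, hi⟩
  · rintro ⟨hcp, hi, hu⟩
    exact ⟨(QuantumGraph.adjoint_eq_self_iff_real hA hu).mpr
      (QuantumGraph.map_star_of_isCompletelyPositive hcp), hi, hu⟩
  · rintro ⟨hsa, hi, hu⟩
    exact ⟨QuantumGraph.isCompletelyPositive_of_real hi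
      ((QuantumGraph.adjoint_eq_self_iff_real hA hu).mp hsa), hi, hu⟩
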